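/- Let $E$ be a (real or complex) Banach space and let $D$ be the infinitesimal generator of a strongly continuous one-parameter group $e^{tD}$, $t\in\mathbb R$, of bounded operators on $E$ with $\sup_{t\in\mathbb R}\|e^{tD}\|<\infty$. For $\sigma>0$ let $\mathbf B_\sigma(D)$ be the set of all $f\in\bigcap_{k}\mathrm{dom}(D^k)$ with $\|D^kf\|\le\sigma^k\|f\|$ for all $k\in\mathbb N$. Let $\mathrm{sinc}\,x=\frac{\sin \pi x}{\pi x}$ ($\mathrm{sinc}\,0=1$), let $\mathrm{sinc}^{(n)}$ be its $n$-th derivative, and read the quotient $\frac{e^{\frac{k\pi}{\sigma}D}f-f}{k\pi/\sigma}$ for $k=0$ as $Df$. Let $n\ge 1$ be an integer. (1) For every $f\in\mathbf B_\sigma(D)$ and $t\in\mathbb R$, $$e^{tD}D^nf=\left(\frac{\sigma}{\pi}\right)^{n-1}\sum_{k\in\mathbb Z}\frac{e^{\frac{k\pi}{\sigma}D}f-f}{\frac{k\pi}{\sigma}}\left\{n\,\mathrm{sinc}^{(n-1)}\!\left(\frac{\sigma t}{\pi}-k\right)+\frac{\sigma t}{\pi}\,\mathrm{sinc}^{(n)}\!\left(\frac{\sigma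 t}{\pi}-k\right)\right\},$$ where the series converges unconditionally in the norm of $E$. (2) In particular, $D^nf=\mathcal Q^n_D(\sigma)f$ for every $f\in\mathbf B_\sigma(D)$, where $$\mathcal Q^n_D(\sigma)f=n\left(\frac{\sigma}{\pi}\right)^{n-1}\sum_{k\in\mathbb Z}\frac{e^{\frac{k\pi}{\sigma}D}f-f}{\frac{k\pi}{\sigma}}\,\mathrm{sinc}^{(n-1)}(-k).$$ This series converges unconditionally in $E$ for every $f\in\mathrm{dom}(D)$. Its part over $k\ne0$ converges unconditionally for every $f\in E$ and defines a bounded linear operator $R$ on $E$, and $$\mathcal Q^n_D(\sigma)f=n\left(\frac{\sigma}{\pi}\right)^{n-1}\mathrm{sinc}^{(n-1)}(0)\,Df+Rf\qquad (f\in\mathrm{dom}(D)).$$ If $n$ is even, then $\mathcal Q^n_D(\sigma)f=Rf$ on $\mathrm{dom}(D)$, so that $\mathcal Q^n_D(\sigma)$ is given by a bounded operator on $E$. For every $n\ge1$ the operator $\mathcal Q^n_D(\sigma)$ is bounded, in the norm of $E$, on the linear span of $\mathbf B_\sigma(D)$. -/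

import Mathlib

open Filter Topology

/-- A strongly continuous one-parameter group `t ↦ e^{tD}`, `t ∈ ℝ`, of bounded linear operators. -/
structure StronglyContinuousGroup (𝕜 E : Type*) [RCLike 𝕜] [NormedAddCommGroup E]
    [NormedSpace 𝕜 E] where
  /-- The operator `e^{tD}`. -/
  op : ℝ → E →L[𝕜] E
  op_zero : op 0 = ContinuousLinearMap.id 𝕜 E
  op_add : ∀ s t : ℝ, op (s + t) = (op s).comp (op t)
  continuous_orbit : ∀ f : E, Continuous fun t : ℝ => op t f

namespace StronglyContinuousGroup

variable {𝕜 E : Type*} [RCLike 𝕜] [NormedAddCommGroup E] [NormedSpace 𝕜 E]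

/-- `g` is the limit of the difference quotients `(e^{tD} f - f) / t` as `t → 0`, `t ≠ 0`. -/
def HasVelocity (T : StronglyContinuousGroup 𝕜 E) (f g : E) : Prop :=
  Tendsto (fun t : ℝ => ((t : ℝ) : 𝕜)⁻¹ • (T.op t f - f)) (𝓝[≠] 0) (𝓝 g)

theorem HasVelocity.unique {T : StronglyContinuousGroup 𝕜 E} {f g h : E}
    (hg : T.HasVelocity f g) (hh : T.HasVelocity f h) : g = h :=
  tendsto_nhds_unique hg hh

theorem HasVelocity.add {T : StronglyContinuousGroup 𝕜 E} {f g f₁ g₁ : E}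
    (h : T.HasVelocity f g) (h₁ : T.HasVelocity f₁ g₁) :
    T.HasVelocity (f + f₁) (g + g₁) := by
  refine (Tendsto.add h h₁).congr fun t => ?_
  rw [map_add, ← smul_add]
  congr 1
  abel

theorem HasVelocity.smul {T : StronglyContinuousGroup 𝕜 E} {f g : E} (c : 𝕜)
    (h : T.HasVelocity f g) : T.HasVelocity (c • f) (c • g) := by
  refine (Tendsto.const_smul h c).congr fun t => ?_
  rw [map_smul, ← smul_sub, smul_comm]

theorem HasVelocity.zero (T : StronglyContinuousGroup 𝕜 E) : T.HasVelocity 0 0 := by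
  simp [HasVelocity]

/-- The infinitesimal generator `D` of the group, an operator in `E` defined on the vectors `f`
for which `(e^{tD} f - f) / t` has a limit as `t → 0`, the value `D f` being that limit. -/
noncomputable def generator (T : StronglyContinuousGroup 𝕜 E) : E →ₗ.[𝕜] E where
  domain :=
    { carrier := {f | ∃ g, T.HasVelocity f g}
      add_mem' := fun ⟨_, h⟩ ⟨_, h₁⟩ => ⟨_, h.add h₁⟩
      zero_mem' := ⟨0, HasVelocity.zero T⟩
      smul_mem' := fun c _ ⟨_, h⟩ => ⟨_, h.smul c⟩ }
  toFun :=
    { toFun := fun f => Classical.choose f.2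
      map_add' := fun f f₁ => (Classical.choose_spec (f + f₁).2).unique
        ((Classical.choose_spec f.2).add (Classical.choose_spec f₁.2))
      map_smul' := fun c f => (Classical.choose_spec (c • f).2).unique
        ((Classical.choose_spec f.2).smul c) }

theorem hasVelocity_generator (T : StronglyContinuousGroup 𝕜 E) (f : T.generator.domain) :
    T.HasVelocity (f : E) (T.generator f) :=
  Classical.choose_spec f.2

end StronglyContinuousGroup

section OperatorPowers

variable {𝕜 E : Type*} [RCLike 𝕜] [NormedAddCommGroup E] [NormedSpace 𝕜 E]

/-- The power `A ^ k` of an unbounded operator `A`: `A ^ 0` is the identity of `E`, and the domain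
of `A ^ (k + 1)` consists of the `f` in the domain of `A ^ k` such that `A ^ k f` lies in the domain
of `A`, with `A ^ (k + 1) f = A (A ^ k f)`. -/
noncomputable def operatorPow (A : E →ₗ.[𝕜] E) : ℕ → (E →ₗ.[𝕜] E)
  | 0 => ⟨⊤, (⊤ : Submodule 𝕜 E).subtype⟩
  | k + 1 =>
    { domain :=
        { carrier := {f | ∃ h : f ∈ (operatorPow A k).domain, operatorPow A k ⟨f, h⟩ ∈ A.domain}
          add_mem' := by
            rintro f g ⟨hf, hf'⟩ ⟨hg, hg'⟩
            refine ⟨add_mem hf hg, ?_⟩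
            have := add_mem hf' hg'
            rwa [← LinearPMap.map_add] at this
          zero_mem' := by
            refine ⟨zero_mem _, ?_⟩
            have : operatorPow A k 0 ∈ A.domain := by
              rw [LinearPMap.map_zero]; exact zero_mem _
            exact this
          smul_mem' := by
            rintro c f ⟨hf, hf'⟩
            refine ⟨Submodule.smul_mem _ c hf, ?_⟩
            have := Submodule.smul_mem _ c hf'
            rwa [← LinearPMap.map_smul] at this }
      toFun :=
        { toFun := fun f => A ⟨operatorPow A k ⟨f, f.2.1⟩, f.2.2⟩
          map_add' := by
            intro f g
            rw [← LinearPMap.map_add]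
            congr 1
            apply Subtype.ext
            exact LinearPMap.map_add (operatorPow A k) ⟨f, f.2.1⟩ ⟨g, g.2.1⟩
          map_smul' := by
            intro c f
            rw [RingHom.id_apply, ← LinearPMap.map_smul]
            congr 1
            apply Subtype.ext
            exact LinearPMap.map_smul (operatorPow A k) c ⟨f, f.2.1⟩ } }

/-- The set `B_σ(A)`: the vectors `f` that lie in the domain of every power of `A` and satisfy
`‖A ^ k f‖ ≤ σ ^ k ‖f‖` for every `k`. -/
def bernsteinSpace (A : E →ₗ.[𝕜] E) (σ : ℝ) : Set E :=
  {f | (∀ k, f ∈ (operatorPow A k).domain) ∧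
    ∀ (k : ℕ) (h : f ∈ (operatorPow A k).domain), ‖operatorPow A k ⟨f, h⟩‖ ≤ σ ^ k * ‖f‖}

theorem bernsteinSpace_mem_domain {A : E →ₗ.[𝕜] E} {σ : ℝ} {f : E}
    (hf : f ∈ bernsteinSpace A σ) : f ∈ A.domain :=
  (hf.1 1).2

end OperatorPowers

/-- The `n`-th derivative of the normalized cardinal sine `sinc x = sin (π x) / (π x)`,
`sinc 0 = 1`. -/
noncomputable def sincDeriv (n : ℕ) (x : ℝ) : ℝ :=
  iteratedDeriv n (fun y : ℝ => Real.sinc (Real.pi * y)) x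

namespace StronglyContinuousGroup

variable {𝕜 E : Type*} [RCLike 𝕜] [NormedAddCommGroup E] [NormedSpace 𝕜 E]

/-- The sampled difference quotient `(e^{sD} f - f) / s` at `s = kπ/σ`, read as `D f` for `k = 0`. -/
noncomputable def sampleQuotient (T : StronglyContinuousGroup 𝕜 E) (σ : ℝ)
    (f : T.generator.domain) (k : ℤ) : E :=
  if k = 0 then T.generator f
  else ((k * Real.pi / σ : ℝ) : 𝕜)⁻¹ • (T.op (k * Real.pi / σ) (f : E) - (f : E))

/-- The operator `Q^n_D(σ)` on the domain of `D`:
`Q^n_D(σ) f = n (σ/π)^(n-1) ∑_k sinc^{(n-1)}(-k) (e^{kπD/σ} f - f) / (kπ/σ)`. -/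
noncomputable def samplingOperator (T : StronglyContinuousGroup 𝕜 E) (σ : ℝ) (n : ℕ)
    (f : T.generator.domain) : E :=
  ((n * (σ / Real.pi) ^ (n - 1) : ℝ) : 𝕜) •
    ∑' k : ℤ, ((sincDeriv (n - 1) (-(k : ℝ)) : ℝ) : 𝕜) • T.sampleQuotient σ f k

end StronglyContinuousGroup

/-! After rescaling time by `π/σ`, the orbit of `f` has derivatives of order `n` bounded by `C π ^
n`. Composed with a real functional, it extends to an entire `g` with `‖g z‖ ≤ B exp (π |Im z|)`, by
Taylor's formula and Phragmén–Lindelöf (`exists_entire_extension`).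

For such `g`, `g z - g 0 = ∑ q_k z sinc (z - k)` with `q_k = (g k - g 0) / k` and `q_0 = g' 0`.
Indeed, the error of the `N`-th symmetric partial sum vanishes at the integers `|k| ≤ N`, doubly at
`0`. Divided by `sin (π z)`, it is bounded by a harmonic sum on the square of half-side `N + 1/2`
and vanishes at `0`. The Schwarz lemma then gains a factor `1/N`, which beats the harmonic sum
(`norm_sub_cardinalSum_le`).

Weights and difference quotients are both `O(1/|k|)`, so the vector series converges absolutely.
Hahn–Banach identifies its sum, and termwise differentiation yields the formula for every `n ≥ 1`
(`hasSum_sampleWeight`).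

At `t = 0` this is `D^n f = Q f`. For boundedness on the span, the formula is evaluated at a time
where the `k = 0` weight vanishes: `D f` drops out, and the other terms are controlled by `‖f‖`
(`exists_bernstein_bound`). The remainder `R` is a series of operators converging absolutely in
operator norm. -/

/-! ### Removable singularities, the entire sinc, and truncated cardinal series. -/

/-- The zeros of `s` are simple, so by l'Hôpital the value `f'/s'` makes the quotient continuous
there, and isolated singularities of continuous functions are removable. -/
theorem exists_differentiableOn_quotient {f s : ℂ → ℂ} {U : Set ℂ}
    (hf : Differentiable ℂ f) (hs : Differentiable ℂ s)
    (hs' : ∀ z ∈ U, s z = 0 → deriv s z ≠ 0) (hf0 : ∀ z ∈ U, s z = 0 → f z = 0) :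
    ∃ q : ℂ → ℂ, DifferentiableOn ℂ q U ∧ ∀ z ∈ U, f z = q z * s z := by
  classical
  refine ⟨fun z => if s z = 0 then deriv f z / deriv s z else f z / s z, ?_, ?_⟩
  · have key : ∀ z, s z ≠ 0 → DifferentiableAt ℂ
        (fun z => if s z = 0 then deriv f z / deriv s z else f z / s z) z := by
      intro z hz
      refine ((hf z).div (hs z) hz).congr_of_eventuallyEq ?_
      filter_upwards [(hs z).continuousAt.eventually_ne hz] with w hw
      simp [hw]
    intro z hz
    refine DifferentiableAt.differentiableWithinAt ?_
    by_cases h0 : s z = 0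
    · have hne : ∀ᶠ w in 𝓝[≠] z, s w ≠ 0 := by
        have := (hs z).hasDerivAt.eventually_ne (c := 0) (hs' z hz h0)
        simpa [h0] using this
      refine (Complex.analyticAt_of_differentiable_on_punctured_nhds_of_continuousAt
        (hne.mono key) ?_).differentiableAt
      rw [continuousAt_iff_punctured_nhds]
      simp only [h0, if_true]
      have h1 := (hasDerivAt_iff_tendsto_slope.1 (hf z).hasDerivAt).div
        (hasDerivAt_iff_tendsto_slope.1 (hs z).hasDerivAt) (hs' z hz h0)
      refine h1.congr' ?_
      filter_upwards [hne, self_mem_nhdsWithin] with w hw hwz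
      have : w - z ≠ 0 := sub_ne_zero.2 hwz
      simp only [Pi.div_apply, slope_def_field, hf0 z hz h0, h0, sub_zero, hw, if_false]
      field_simp
    · exact key z h0
  · intro z hz
    by_cases h0 : s z = 0
    · simp [h0, hf0 z hz h0]
    · simp [h0]

/-- The entire function extending `sin (π z) / (π z)`. -/
noncomputable def csinc : ℂ → ℂ :=
  dslope (fun z : ℂ => Complex.sin (Real.pi * z) / Real.pi) 0

theorem hasDerivAt_sin_pi (z : ℂ) :
    HasDerivAt (fun z : ℂ => Complex.sin (Real.pi * z)) (Real.pi * Complex.cos (Real.pi * z)) z := by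
  have h : HasDerivAt (fun z : ℂ => (Real.pi : ℂ) * z) (Real.pi : ℂ) z := by
    simpa using (hasDerivAt_id z).const_mul (Real.pi : ℂ)
  simpa [mul_comm] using h.csin

theorem pi_ne_zero_complex : (Real.pi : ℂ) ≠ 0 := by exact_mod_cast Real.pi_ne_zero

theorem csinc_zero : csinc 0 = 1 := by
  have h := ((hasDerivAt_sin_pi 0).div_const (Real.pi : ℂ)).deriv
  simp only [csinc, dslope_same]
  rw [h]
  simp

theorem csinc_mul_self (z : ℂ) : z * csinc z = Complex.sin (Real.pi * z) / Real.pi := by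
  have := sub_smul_dslope (fun z : ℂ => Complex.sin (Real.pi * z) / Real.pi) 0 z
  simpa [csinc] using this

theorem differentiable_csinc : Differentiable ℂ csinc := by
  have : DifferentiableOn ℂ csinc Set.univ :=
    (Complex.differentiableOn_dslope univ_mem).2
      (fun z _ => ((hasDerivAt_sin_pi z).div_const _).differentiableAt.differentiableWithinAt)
  exact differentiableOn_univ.1 this

theorem csinc_ofReal (x : ℝ) : csinc x = (Real.sinc (Real.pi * x) : ℝ) := by
  by_cases hx : x = 0
  · simp [hx, csinc_zero]
  · have h := csinc_mul_self x
    have hx' : (x : ℂ) ≠ 0 := by exact_mod_cast hx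
    rw [Real.sinc_of_ne_zero (mul_ne_zero Real.pi_ne_zero hx)]
    push_cast
    have := pi_ne_zero_complex
    rw [eq_div_iff (by positivity)]
    linear_combination (Real.pi : ℂ) * h + 
      Complex.sin (Real.pi * x) * (div_self this)

theorem sin_pi_int (k : ℤ) : Complex.sin (Real.pi * k) = 0 := by
  rw [mul_comm]; exact Complex.sin_int_mul_pi k

theorem csinc_int {k : ℤ} (hk : k ≠ 0) : csinc k = 0 := by
  have h := csinc_mul_self k
  rw [sin_pi_int] at h
  have : (k : ℂ) ≠ 0 := by exact_mod_cast hk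
  simpa [this] using h

theorem norm_sin_pi_sub_int (z : ℂ) (k : ℤ) :
    ‖Complex.sin (Real.pi * (z - k))‖ = ‖Complex.sin (Real.pi * z)‖ := by
  have : Real.pi * (z - k) = Real.pi * z - k * Real.pi := by ring
  rw [this, Complex.sin_antiperiodic.sub_int_mul_eq, norm_mul]
  rcases Int.even_or_odd k with h | h <;> simp [h]

/-- The symmetric partial sum of the cardinal series. -/
noncomputable def cardinalSum (q : ℤ → ℂ) (N : ℕ) (z : ℂ) : ℂ :=
  ∑ k ∈ Finset.Icc (-(N : ℤ)) N, q k * (z * csinc (z - k))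

theorem differentiable_cardinalSum (q : ℤ → ℂ) (N : ℕ) : Differentiable ℂ (cardinalSum q N) := by
  unfold cardinalSum
  refine Differentiable.fun_sum fun k _ => ?_
  exact ((differentiable_id.mul
    (differentiable_csinc.comp (differentiable_id.sub_const _))).const_mul _)

theorem cardinalSum_int (q : ℤ → ℂ) (N : ℕ) {j : ℤ} (hj : j ∈ Finset.Icc (-(N : ℤ)) N) :
    cardinalSum q N j = q j * j := by
  unfold cardinalSum
  rw [Finset.sum_eq_single_of_mem j hj]
  · simp [csinc_zero]
  · intro k _ hk
    have : ((j : ℂ) - k) = ((j - k : ℤ) : ℂ) := by push_cast; ring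
    rw [this, csinc_int (sub_ne_zero.2 hk.symm)]
    simp

theorem deriv_cardinalSum_zero (q : ℤ → ℂ) (N : ℕ) : deriv (cardinalSum q N) 0 = q 0 := by
  have h : HasDerivAt (cardinalSum q N)
      (∑ k ∈ Finset.Icc (-(N : ℤ)) N, q k * csinc (-k)) 0 := by
    unfold cardinalSum
    refine HasDerivAt.fun_sum fun k _ => ?_
    have hd : DifferentiableAt ℂ (fun z : ℂ => csinc (z - k)) 0 :=
      (differentiable_csinc.comp (differentiable_id.sub_const _)) 0
    simpa using (((hasDerivAt_id (0 : ℂ)).mul hd.hasDerivAt).const_mul (q k))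
  rw [h.deriv, Finset.sum_eq_single_of_mem 0 (by simp)]
  · simp [csinc_zero]
  · intro k _ hk
    have : (-(k : ℂ)) = ((-k : ℤ) : ℂ) := by push_cast; ring
    rw [this, csinc_int (neg_ne_zero.2 hk), mul_zero]

/-! ### Estimates on the boundary of the square of half-side `N + 1/2`. -/

theorem normSq_sin (z : ℂ) :
    Complex.normSq (Complex.sin z) = Real.sin z.re ^ 2 + Real.sinh z.im ^ 2 := by
  have h : Complex.sin z = ((Real.sin z.re * Real.cosh z.im : ℝ) : ℂ) +
      ((Real.cos z.re * Real.sinh z.im : ℝ) : ℂ) * Complex.I := by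
    rw [Complex.sin_eq]; push_cast; ring
  rw [h, Complex.normSq_add_mul_I]
  have h1 := Real.sin_sq_add_cos_sq z.re
  have h2 := Real.cosh_sq z.im
  rw [mul_pow, mul_pow, h2]
  linear_combination Real.sinh z.im ^ 2 * h1

/-- On the vertical sides `sin² (π Re z) = 1`, so `|sin (π z)| = cosh (π Im z)`. -/
theorem norm_sin_pi_lower_re (N : ℕ) {z : ℂ} (h : |z.re| = N + 1 / 2) :
    Real.exp (Real.pi * |z.im|) / 4 ≤ ‖Complex.sin (Real.pi * z)‖ := by
  have hs : Real.sin (Real.pi * z.re) ^ 2 = 1 := by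
    have h0 : Real.cos (Real.pi * z.re) = 0 := by
      rw [← Real.cos_abs, abs_mul, abs_of_pos Real.pi_pos, h, Real.cos_eq_zero_iff]
      exact ⟨N, by push_cast; ring⟩
    have := Real.sin_sq_add_cos_sq (Real.pi * z.re)
    rw [h0] at this
    linarith
  rw [Complex.norm_def]
  refine Real.le_sqrt_of_sq_le ?_
  rw [normSq_sin]
  simp only [Complex.mul_re, Complex.mul_im, Complex.ofReal_re, Complex.ofReal_im, zero_mul,
    sub_zero, add_zero]
  rw [hs, add_comm, ← Real.cosh_sq, ← Real.cosh_abs, abs_mul, abs_of_pos Real.pi_pos]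
  refine pow_le_pow_left₀ (by positivity) ?_ 2
  rw [Real.cosh_eq]
  linarith [Real.exp_pos (Real.pi * |z.im|), Real.exp_pos (-(Real.pi * |z.im|))]

/-- Here `|sin (π z)| ≥ |sinh (π Im z)|`, and `exp (π |Im z|) ≥ 2` is enough to absorb the decaying
exponential. -/
theorem norm_sin_pi_lower_im {z : ℂ} (h : 1 / 2 ≤ |z.im|) :
    Real.exp (Real.pi * |z.im|) / 4 ≤ ‖Complex.sin (Real.pi * z)‖ := by
  rw [Complex.norm_def]
  refine Real.le_sqrt_of_sq_le ?_
  rw [normSq_sin]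
  simp only [Complex.mul_re, Complex.mul_im, Complex.ofReal_re, Complex.ofReal_im, zero_mul,
    sub_zero, add_zero]
  rw [← sq_abs (Real.sinh _), Real.abs_sinh, abs_mul, abs_of_pos Real.pi_pos]
  refine le_add_of_nonneg_of_le (sq_nonneg _) (pow_le_pow_left₀ (by positivity) ?_ 2)
  have h1 : 1 ≤ Real.pi * |z.im| := by nlinarith [Real.pi_gt_three]
  have h2 : 2 ≤ Real.exp (Real.pi * |z.im|) := by
    linarith [Real.add_one_le_exp (Real.pi * |z.im|)]
  have h3 : Real.exp (Real.pi * |z.im|) * Real.exp (-(Real.pi * |z.im|)) = 1 := by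
    rw [← Real.exp_add]; simp
  rw [Real.sinh_eq]
  nlinarith [Real.exp_pos (-(Real.pi * |z.im|))]

theorem norm_sub_int_lower {N : ℕ} {z : ℂ} (h : |z.re| = N + 1 / 2 ∨ |z.im| = N + 1 / 2) (k : ℤ) :
    (N : ℝ) + 1 / 2 - |(k : ℝ)| ≤ ‖z - k‖ := by
  rcases h with h | h
  · have h1 := Complex.abs_re_le_norm (z - k)
    simp only [Complex.sub_re, Complex.intCast_re] at h1
    linarith [abs_sub_abs_le_abs_sub z.re k]
  · have h1 := Complex.abs_im_le_norm (z - k)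
    simp only [Complex.sub_im, Complex.intCast_im, sub_zero] at h1
    linarith [abs_nonneg (k : ℝ)]

theorem norm_mul_csinc (z w : ℂ) (k : ℤ) (hk : z - k ≠ 0) :
    ‖w * (z * csinc (z - k))‖ =
      ‖w‖ * ‖z‖ / ‖z - k‖ / Real.pi * ‖Complex.sin (Real.pi * z)‖ := by
  have h := congrArg norm (csinc_mul_self (z - k))
  rw [norm_mul, norm_div, norm_sin_pi_sub_int, Complex.norm_of_nonneg Real.pi_pos.le] at h
  have h0 : ‖z - k‖ ≠ 0 := norm_ne_zero_iff.2 hk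
  have : ‖csinc (z - k)‖ = ‖Complex.sin (Real.pi * z)‖ / Real.pi / ‖z - k‖ := by
    rw [← h]; field_simp
  rw [norm_mul, norm_mul, this]
  field_simp

/-- Bounding `‖z‖ ≤ ‖z - k‖ + |k|` splits the term into `‖w‖`, at most `2K / (|k| + 1)`, and `K / ‖z
- k‖`, where `‖z - k‖` is at least half of `N - |k| + 1`. Both summands become harmonic when summed
over `k`. -/
theorem sample_term_le {N : ℕ} {z w : ℂ} {K : ℝ} {k : ℤ}
    (h : |z.re| = N + 1 / 2 ∨ |z.im| = N + 1 / 2) (hk : k ∈ Finset.Icc (-(N : ℤ)) N)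
    (hw : ‖w‖ ≤ K) (hwk : ‖w‖ * |(k : ℝ)| ≤ K) :
    ‖w‖ * ‖z‖ / ‖z - k‖ ≤
      2 * K * (1 / ((N - k.natAbs : ℕ) + 1 : ℝ) + 1 / (k.natAbs + 1 : ℝ)) := by
  have hkN : k.natAbs ≤ N := by
    have := Finset.mem_Icc.1 hk; omega
  have hcast : ((N - k.natAbs : ℕ) : ℝ) = N - |(k : ℝ)| := by
    rw [Nat.cast_sub hkN, Nat.cast_natAbs, Int.cast_abs]
  have hcast' : ((k.natAbs : ℕ) : ℝ) = |(k : ℝ)| := by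
    rw [Nat.cast_natAbs, Int.cast_abs]
  rw [hcast, hcast']
  have hkN' : |(k : ℝ)| ≤ N := by rw [← hcast']; exact_mod_cast hkN
  have hlow := norm_sub_int_lower h k
  have hK : 0 ≤ K := (norm_nonneg w).trans hw
  have ha : 0 ≤ |(k : ℝ)| := abs_nonneg _
  have hd : 0 < ‖z - k‖ := by linarith
  have htri : ‖z‖ ≤ ‖z - k‖ + |(k : ℝ)| := by
    have := norm_add_le (z - k) k
    simpa using this
  have h1 : ‖w‖ * ‖z‖ / ‖z - k‖ ≤ ‖w‖ + K / ‖z - k‖ := by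
    rw [div_le_iff₀ hd, add_mul, div_mul_cancel₀ _ hd.ne']
    nlinarith [norm_nonneg w]
  have h2 : K / ‖z - k‖ ≤ 2 * K * (1 / (N - |(k : ℝ)| + 1)) := by
    rw [mul_one_div, div_le_div_iff₀ hd (by linarith)]
    nlinarith
  have h3 : ‖w‖ ≤ 2 * K * (1 / (|(k : ℝ)| + 1)) := by
    rw [mul_one_div, le_div_iff₀ (by linarith)]
    linarith
  linarith

theorem sum_Icc_natAbs_le (u : ℕ → ℝ) (hu : ∀ j, 0 ≤ u j) (N : ℕ) :
    ∑ k ∈ Finset.Icc (-(N : ℤ)) N, u k.natAbs ≤ 2 * ∑ j ∈ Finset.range (N + 1), u j := by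
  have h := Finset.sum_Icc_of_even_eq_range (f := fun k : ℤ => u k.natAbs)
    (fun k => by simp) N
  rw [h]
  simp
  exact hu 0

theorem sum_weights_le (N : ℕ) :
    ∑ k ∈ Finset.Icc (-(N : ℤ)) N,
      (1 / ((N - k.natAbs : ℕ) + 1 : ℝ) + 1 / (k.natAbs + 1 : ℝ)) ≤
      4 * ∑ j ∈ Finset.range (N + 1), 1 / (j + 1 : ℝ) := by
  refine (sum_Icc_natAbs_le (fun j => 1 / ((N - j : ℕ) + 1 : ℝ) + 1 / (j + 1 : ℝ))
    (fun j => by positivity) N).trans_eq ?_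
  rw [Finset.sum_add_distrib]
  have := Finset.sum_range_reflect (fun j : ℕ => 1 / (j + 1 : ℝ)) (N + 1)
  simp only [Nat.add_sub_cancel] at this
  rw [this]
  ring

/-- The error of the truncated cardinal series, relative to `sin (π z)`. -/
theorem norm_sub_cardinalSum_le {g : ℂ → ℂ} {B K : ℝ} (hg : Differentiable ℂ g)
    (hB : ∀ z, ‖g z‖ ≤ B * Real.exp (Real.pi * |z.im|)) {q : ℤ → ℂ}
    (hq : ∀ k, q k * k = g k - g 0) (hq0 : q 0 = deriv g 0)
    (hK : ∀ k, ‖q k‖ ≤ K) (hK' : ∀ k : ℤ, ‖q k‖ * |(k : ℝ)| ≤ K) (N : ℕ) {z : ℂ}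
    (hz : ‖z‖ < N + 1 / 2) :
    ‖g z - g 0 - cardinalSum q N z‖ ≤
      (8 * B + 8 * K * ∑ j ∈ Finset.range (N + 1), 1 / (j + 1 : ℝ)) / (N + 1 / 2) * ‖z‖ *
        ‖Complex.sin (Real.pi * z)‖ := by
  set R : ℝ := N + 1 / 2 with hR
  set f : ℂ → ℂ := fun z => g z - g 0 - cardinalSum q N z with hf
  set s : ℂ → ℂ := fun z => Complex.sin (Real.pi * z) with hs
  -- This open strip contains the closed square, and its only zeros of `sin (π z)` are the integers
  -- `|k| ≤ N`, where the error vanishes.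
  set V : Set ℂ := {z | |z.re| < N + 1} with hV
  have hVo : IsOpen V := isOpen_lt (by fun_prop) (by fun_prop)
  have hfd : Differentiable ℂ f := (hg.sub_const _).sub (differentiable_cardinalSum q N)
  have hsd : Differentiable ℂ s := fun z => (hasDerivAt_sin_pi z).differentiableAt
  have hzero : ∀ z ∈ V, s z = 0 → ∃ k ∈ Finset.Icc (-(N : ℤ)) N, z = k := by
    intro z hz h0
    obtain ⟨k, hk⟩ := Complex.sin_eq_zero_iff.1 h0
    have hzk : z = k := by
      have := pi_ne_zero_complex
      apply mul_left_cancel₀ this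
      rw [hk, mul_comm]
    refine ⟨k, ?_, hzk⟩
    have h1 : |(k : ℝ)| < N + 1 := by simpa [hV, hzk] using hz
    have h2 : |k| < (N : ℤ) + 1 := by exact_mod_cast h1
    rw [Finset.mem_Icc]
    rw [abs_lt] at h2
    omega
  obtain ⟨Q, hQd, hQ⟩ := exists_differentiableOn_quotient (U := V) hfd hsd (by
      intro z hz h0
      rw [(hasDerivAt_sin_pi z).deriv]
      refine mul_ne_zero pi_ne_zero_complex fun h => ?_
      have := Complex.sin_sq_add_cos_sq (Real.pi * z)
      have h0' : Complex.sin (Real.pi * z) = 0 := h0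
      rw [h0', h] at this
      simp at this) (by
      intro z hz h0
      obtain ⟨k, hk, rfl⟩ := hzero z hz h0
      simp [hf, cardinalSum_int q N hk, hq])
  -- The choice `q 0 = g' 0` makes the zero of the error at `0` double, so one zero survives
  -- division by the sine.
  have hQ0 : Q 0 = 0 := by
    have h0V : (0 : ℂ) ∈ V := by simp [hV]; positivity
    have hd1 : deriv f 0 = 0 := by
      have h1 := ((hg 0).hasDerivAt.sub_const (g 0)).sub
        (differentiable_cardinalSum q N 0).hasDerivAt
      have h2 : HasDerivAt f (deriv g 0 - deriv (cardinalSum q N) 0) 0 := h1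
      rw [h2.deriv, deriv_cardinalSum_zero, hq0, sub_self]
    have hQa : DifferentiableAt ℂ Q 0 := (hQd 0 h0V).differentiableAt (hVo.mem_nhds h0V)
    have hd2 : HasDerivAt f (Q 0 * Real.pi) 0 := by
      have h3 := hQa.hasDerivAt.mul (hasDerivAt_sin_pi 0)
      simp only [mul_zero, Complex.sin_zero, Complex.cos_zero, mul_one, zero_add] at h3
      refine h3.congr_of_eventuallyEq ?_
      filter_upwards [hVo.mem_nhds h0V] with w hw
      exact hQ w hw
    rw [hd2.deriv] at hd1
    simpa [pi_ne_zero_complex] using hd1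
  set C : ℝ := 8 * B + 8 * K * ∑ j ∈ Finset.range (N + 1), 1 / (j + 1 : ℝ) with hC
  have hB0 : 0 ≤ B := by simpa using (norm_nonneg _).trans (hB 0)
  have hRpos : 0 < R := by positivity
  set U : Set ℂ := Set.Ioo (-R) R ×ℂ Set.Ioo (-R) R with hU
  have hUcl : closure U = Set.Icc (-R) R ×ℂ Set.Icc (-R) R := by
    rw [hU, Complex.closure_reProdIm, closure_Ioo (by linarith)]
  have hclV : closure U ⊆ V := by
    rw [hUcl]
    intro w hw
    have h1 := (Complex.mem_reProdIm.1 hw).1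
    have : |w.re| ≤ R := abs_le.2 h1
    show |w.re| < N + 1
    linarith
  have hfront : ∀ w ∈ frontier U, ‖Q w‖ ≤ C := by
    intro w hw
    have hwV : w ∈ V := hclV (frontier_subset_closure hw)
    have hre : |w.re| = R ∨ |w.im| = R := by
      rw [hU, Complex.frontier_reProdIm, frontier_Ioo (by linarith)] at hw
      rcases hw with hw | hw
      · right
        rcases (Complex.mem_reProdIm.1 hw).2 with h | h
        · rw [h, abs_neg, abs_of_pos hRpos]
        · rw [show w.im = R from h, abs_of_pos hRpos]
      · left
        rcases (Complex.mem_reProdIm.1 hw).1 with h | h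
        · rw [h, abs_neg, abs_of_pos hRpos]
        · rw [show w.re = R from h, abs_of_pos hRpos]
    have hsl : Real.exp (Real.pi * |w.im|) / 4 ≤ ‖s w‖ := by
      rcases hre with h | h
      · exact norm_sin_pi_lower_re N h
      · refine norm_sin_pi_lower_im ?_
        rw [h, hR]
        linarith [Nat.cast_nonneg (α := ℝ) N]
    have hspos : 0 < ‖s w‖ := lt_of_lt_of_le (by positivity) hsl
    have hg1 : ‖g w‖ ≤ 4 * B * ‖s w‖ := by
      refine (hB w).trans ?_
      nlinarith
    have hg2 : ‖g 0‖ ≤ 4 * B * ‖s w‖ := by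
      have h1 := hB 0
      simp only [Complex.zero_im, abs_zero, mul_zero, Real.exp_zero, mul_one] at h1
      have h2 : 1 ≤ Real.exp (Real.pi * |w.im|) := Real.one_le_exp (by positivity)
      nlinarith
    have hcs : ‖cardinalSum q N w‖ ≤
        (8 * K * ∑ j ∈ Finset.range (N + 1), 1 / (j + 1 : ℝ)) * ‖s w‖ := by
      have hK0 : 0 ≤ K := (norm_nonneg _).trans (hK 0)
      calc ‖cardinalSum q N w‖
          ≤ ∑ k ∈ Finset.Icc (-(N : ℤ)) N, (2 * K * (1 / ((N - k.natAbs : ℕ) + 1 : ℝ) +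
              1 / (k.natAbs + 1 : ℝ))) * ‖s w‖ := by
            refine norm_sum_le_of_le _ fun k hk => ?_
            have hne : w - k ≠ 0 := by
              intro h
              have hwk : w = k := sub_eq_zero.1 h
              have : s w = 0 := by rw [hwk]; exact sin_pi_int k
              simp [this] at hspos
            rw [norm_mul_csinc w (q k) k hne]
            refine mul_le_mul_of_nonneg_right ?_ (norm_nonneg _)
            refine (div_le_self (by positivity) (by linarith [Real.pi_gt_three])).trans ?_
            exact sample_term_le hre hk (hK k) (hK' k)
        _ = 2 * K * (∑ k ∈ Finset.Icc (-(N : ℤ)) N, (1 / ((N - k.natAbs : ℕ) + 1 : ℝ) +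
              1 / (k.natAbs + 1 : ℝ))) * ‖s w‖ := by
            rw [← Finset.sum_mul, ← Finset.mul_sum]
        _ ≤ 2 * K * (4 * ∑ j ∈ Finset.range (N + 1), 1 / (j + 1 : ℝ)) * ‖s w‖ := by
            gcongr
            exact sum_weights_le N
        _ = _ := by ring
    have hfw : ‖f w‖ ≤ C * ‖s w‖ := by
      have h1 : ‖f w‖ ≤ ‖g w‖ + ‖g 0‖ + ‖cardinalSum q N w‖ :=
        (norm_sub_le _ _).trans (add_le_add_left (norm_sub_le _ _) _)
      rw [hC, add_mul]
      linarith
    rw [hQ w hwV, norm_mul] at hfw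
    exact le_of_mul_le_mul_right hfw hspos
  -- Maximum modulus carries the boundary bound into the square.
  have hQle : ∀ w ∈ closure U, ‖Q w‖ ≤ C := fun w hw =>
    Complex.norm_le_of_forall_mem_frontier_norm_le
      ((Metric.isBounded_Ioo _ _).reProdIm (Metric.isBounded_Ioo _ _))
      ((hQd.mono hclV).diffContOnCl) hfront hw
  have hball : Metric.ball (0 : ℂ) R ⊆ closure U := by
    intro w hw
    rw [mem_ball_zero_iff] at hw
    rw [hUcl, Complex.mem_reProdIm]
    exact ⟨abs_le.1 ((Complex.abs_re_le_norm w).trans hw.le),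
      abs_le.1 ((Complex.abs_im_le_norm w).trans hw.le)⟩
  -- Schwarz lemma on the inscribed disc of radius `R`: this is the source of the factor `‖z‖ / (N +
  -- 1/2)`.
  have hsch := Complex.dist_le_div_mul_dist_of_mapsTo_ball (R₂ := C)
    (hQd.mono (hball.trans hclV)) (by
      intro w hw
      rw [hQ0, mem_closedBall_zero_iff]
      exact hQle w (hball hw)) (mem_ball_zero_iff.2 hz)
  rw [hQ0, dist_zero_right, dist_zero_right] at hsch
  have hzV : z ∈ V := hclV (hball (mem_ball_zero_iff.2 hz))
  show ‖f z‖ ≤ _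
  rw [hQ z hzV, norm_mul]
  gcongr

/-- The Cesàro means of `1 / (j + 1)` tend to `0`; no logarithmic asymptotics are needed. -/
theorem tendsto_harmonic_div (a b : ℝ) :
    Tendsto (fun N : ℕ => (a + b * ∑ j ∈ Finset.range (N + 1), 1 / (j + 1 : ℝ)) /
      (N + 1 / 2)) atTop (𝓝 0) := by
  have h1 := (tendsto_one_div_add_atTop_nhds_zero_nat (𝕜 := ℝ)).cesaro.comp (tendsto_add_atTop_nat 1)
  have h2 : Tendsto (fun N : ℕ => a * (1 / ((N : ℝ) + 1)) + b * (((N + 1 : ℕ) : ℝ)⁻¹ *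
      ∑ j ∈ Finset.range (N + 1), 1 / (j + 1 : ℝ))) atTop (𝓝 0) := by
    simpa using ((tendsto_one_div_add_atTop_nhds_zero_nat (𝕜 := ℝ)).const_mul a).add
      (h1.const_mul b)
  have h3 : Tendsto (fun N : ℕ => ((N : ℝ) + 1) / (N + 1 / 2)) atTop (𝓝 1) := by
    have h4 : Tendsto (fun N : ℕ => (1 / 2 : ℝ) / (N + 1 / 2)) atTop (𝓝 0) :=
      Tendsto.const_div_atTop (tendsto_atTop_add_const_right _ _ tendsto_natCast_atTop_atTop) _
    have := h4.const_add 1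
    rw [add_zero] at this
    refine this.congr fun N => ?_
    have : (0 : ℝ) < N + 1 / 2 := by positivity
    field_simp
    ring
  have := h2.mul h3
  rw [zero_mul] at this
  refine this.congr fun N => ?_
  push_cast
  have h5 : (0 : ℝ) < N + 1 / 2 := by positivity
  have h6 : (0 : ℝ) < N + 1 := by positivity
  field_simp

/-- **Cardinal series** for the difference quotient of an entire function of exponential type `π`
that is bounded on the real line. -/
theorem tendsto_cardinalSum {g : ℂ → ℂ} {B : ℝ} (hg : Differentiable ℂ g)
    (hB : ∀ z, ‖g z‖ ≤ B * Real.exp (Real.pi * |z.im|)) {q : ℤ → ℂ}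
    (hq : ∀ k, q k * k = g k - g 0) (hq0 : q 0 = deriv g 0) (z : ℂ) :
    Tendsto (fun N => cardinalSum q N z) atTop (𝓝 (g z - g 0)) := by
  have hB0 : 0 ≤ B := by simpa using (norm_nonneg _).trans (hB 0)
  have hqk : ∀ k : ℤ, ‖q k‖ * |(k : ℝ)| ≤ 2 * B := by
    intro k
    have h1 := congrArg norm (hq k)
    rw [norm_mul, Complex.norm_intCast] at h1
    rw [h1]
    have h2 := hB k
    have h3 := hB 0
    simp only [Complex.intCast_im, Complex.zero_im, abs_zero, mul_zero, Real.exp_zero,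
      mul_one] at h2 h3
    linarith [norm_sub_le (g k) (g 0)]
  have hK : ∀ k, ‖q k‖ ≤ 2 * B + ‖q 0‖ := by
    intro k
    rcases eq_or_ne k 0 with rfl | hk
    · linarith
    · have h1 : (1 : ℝ) ≤ |(k : ℝ)| := by exact_mod_cast Int.one_le_abs hk
      nlinarith [hqk k, norm_nonneg (q k), norm_nonneg (q 0)]
  have hK' : ∀ k : ℤ, ‖q k‖ * |(k : ℝ)| ≤ 2 * B + ‖q 0‖ := fun k => by
    linarith [hqk k, norm_nonneg (q 0)]
  rw [tendsto_iff_norm_sub_tendsto_zero]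
  have hlim := ((tendsto_harmonic_div (8 * B) (8 * (2 * B + ‖q 0‖))).mul_const ‖z‖).mul_const
    ‖Complex.sin (Real.pi * z)‖
  rw [zero_mul, zero_mul] at hlim
  refine squeeze_zero' (Eventually.of_forall fun _ => norm_nonneg _) ?_ hlim
  obtain ⟨N₀, hN₀⟩ := exists_nat_gt ‖z‖
  filter_upwards [eventually_ge_atTop N₀] with N hN
  rw [norm_sub_rev]
  refine norm_sub_cardinalSum_le hg hB hq hq0 hK hK' N ?_
  have : (N₀ : ℝ) ≤ N := by exact_mod_cast hN
  linarith

/-! ### From derivative bounds on the line to entire functions. -/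

/-- Phragmén–Lindelöf in the upper half-plane for functions of exponential type. -/
theorem norm_le_exp_im_of_nonneg {g : ℂ → ℂ} {C τ : ℝ} (hg : Differentiable ℂ g)
    (hτ : 0 ≤ τ) (hexp : ∀ z, ‖g z‖ ≤ C * Real.exp (τ * ‖z‖)) (hreal : ∀ x : ℝ, ‖g x‖ ≤ C)
    {z : ℂ} (hz : 0 ≤ z.im) : ‖g z‖ ≤ C * Real.exp (τ * z.im) := by
  -- The rotation carries the right half-plane to the upper one. The exponential has modulus one on
  -- the imaginary axis and cancels the growth of type `τ` along the positive real axis.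
  set f : ℂ → ℂ := fun w => g (Complex.I * w) * Complex.exp (-(τ * w)) with hf
  have hfd : Differentiable ℂ f :=
    (hg.comp (differentiable_id.const_mul _)).mul (by fun_prop)
  have hnorm : ∀ w, ‖f w‖ = ‖g (Complex.I * w)‖ * Real.exp (-(τ * w.re)) := by
    intro w
    rw [hf]
    simp only [norm_mul, Complex.norm_exp]
    simp
  have hle : ∀ w : ℂ, 0 ≤ w.re → ‖f w‖ ≤ C * Real.exp (τ * ‖w‖) := by
    intro w hw
    rw [hnorm]
    have h1 := hexp (Complex.I * w)
    rw [norm_mul, Complex.norm_I, one_mul] at h1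
    have h2 : Real.exp (-(τ * w.re)) ≤ 1 := Real.exp_le_one_iff.2 (by nlinarith)
    exact (mul_le_of_le_one_right (norm_nonneg _) h2).trans h1
  have key := PhragmenLindelof.right_half_plane_of_bounded_on_real (f := f) (C := C)
    (z := -Complex.I * z) hfd.diffContOnCl
    ⟨1, one_lt_two, τ, Asymptotics.IsBigO.of_bound C (by
      rw [eventually_inf_principal]
      refine Eventually.of_forall fun w hw => ?_
      rw [Real.rpow_one, Real.norm_of_nonneg (Real.exp_pos _).le]
      exact hle w (le_of_lt hw))⟩
    ⟨C, by
      rw [eventually_map]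
      filter_upwards [eventually_ge_atTop 0] with x hx
      rw [hnorm]
      have h1 := hexp (Complex.I * x)
      rw [norm_mul, Complex.norm_I, one_mul, Complex.norm_of_nonneg hx] at h1
      rw [Complex.ofReal_re, Real.exp_neg, ← div_eq_mul_inv, div_le_iff₀ (Real.exp_pos _)]
      exact h1⟩
    (by
      intro x
      rw [hnorm]
      have h1 := hreal (-x)
      have h2 : Complex.I * (x * Complex.I) = ((-x : ℝ) : ℂ) := by
        push_cast
        linear_combination (x : ℂ) * Complex.I_mul_I
      rw [h2]
      simpa using h1)
    (by simpa using hz)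
  rw [hnorm] at key
  have h3 : Complex.I * (-Complex.I * z) = z := by
    linear_combination (-z) * Complex.I_mul_I
  rw [h3] at key
  have h4 : (-Complex.I * z).re = z.im := by simp
  rw [h4, Real.exp_neg, ← div_eq_mul_inv, div_le_iff₀ (Real.exp_pos _)] at key
  exact key

theorem norm_le_exp_abs_im {g : ℂ → ℂ} {C τ : ℝ} (hg : Differentiable ℂ g)
    (hτ : 0 ≤ τ) (hexp : ∀ z, ‖g z‖ ≤ C * Real.exp (τ * ‖z‖)) (hreal : ∀ x : ℝ, ‖g x‖ ≤ C)
    (z : ℂ) : ‖g z‖ ≤ C * Real.exp (τ * |z.im|) := by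
  rcases le_total 0 z.im with h | h
  · rw [abs_of_nonneg h]
    exact norm_le_exp_im_of_nonneg hg hτ hexp hreal h
  · rw [abs_of_nonpos h]
    have := norm_le_exp_im_of_nonneg (g := fun w => g (-w)) (z := -z)
      (hg.comp differentiable_neg) hτ (fun w => by simpa using hexp (-w))
      (fun x => by simpa using hreal (-x)) (by simpa using h)
    simpa using this

/-- The Taylor series of a function whose `n`-th derivative is bounded by `C τ ^ n`. -/
theorem hasSum_taylor {a : ℕ → ℝ → ℝ} {C τ : ℝ} (hτ : 0 ≤ τ)
    (ha : ∀ n x, HasDerivAt (a n) (a (n + 1) x) x) (hC : ∀ n x, |a n x| ≤ C * τ ^ n) (x : ℝ) :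
    HasSum (fun n : ℕ => a n 0 * (x ^ n / n.factorial)) (a 0 x) := by
  have hC0 : 0 ≤ C := by simpa using (abs_nonneg _).trans (hC 0 0)
  -- Differentiating the Taylor polynomial at `x` in its centre `s` telescopes, leaving only the top
  -- term; the mean value inequality between `0` and `x` then bounds the remainder.
  have hderiv : ∀ (n : ℕ) (s : ℝ), HasDerivAt
      (fun s => ∑ k ∈ Finset.range (n + 1), a k s * ((x - s) ^ k / k.factorial))
      (a (n + 1) s * ((x - s) ^ n / n.factorial)) s := by
    intro n s
    induction n with
    | zero => simpa using ha 0 s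
    | succ n ih =>
      simp only [Finset.sum_range_succ _ (n + 1)]
      have h1 : HasDerivAt (fun s : ℝ => (x - s) ^ (n + 1) / ((n + 1).factorial : ℝ))
          (-((x - s) ^ n / n.factorial)) s := by
        have h2 := (((hasDerivAt_id s).const_sub x).pow (n + 1)).div_const ((n + 1).factorial : ℝ)
        refine h2.congr_deriv ?_
        rw [Nat.factorial_succ]
        push_cast
        have : (n.factorial : ℝ) ≠ 0 := by positivity
        have : (n + 1 : ℝ) ≠ 0 := by positivity
        simp only [id]
        field_simp
      refine (ih.add ((ha (n + 1) s).mul h1)).congr_deriv ?_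
      ring
  have hsum : Summable (fun n : ℕ => a n 0 * (x ^ n / n.factorial)) := by
    refine Summable.of_norm_bounded ((Real.summable_pow_div_factorial (τ * |x|)).mul_left C) ?_
    intro n
    rw [norm_mul, Real.norm_eq_abs, norm_div, norm_pow, Real.norm_eq_abs, Real.norm_natCast,
      mul_pow, mul_div_assoc, ← mul_assoc]
    gcongr
    exact hC n 0
  refine (hsum.hasSum_iff_tendsto_nat).2 ?_
  rw [← tendsto_add_atTop_iff_nat 1, tendsto_iff_norm_sub_tendsto_zero]
  have hlim := (FloorSemiring.tendsto_pow_div_factorial_atTop (τ * |x|)).const_mul (C * τ * |x|)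
  rw [mul_zero] at hlim
  refine squeeze_zero (fun _ => norm_nonneg _) (fun n => ?_) hlim
  have hb := Convex.norm_image_sub_le_of_norm_hasDerivWithin_le (s := Set.uIcc 0 x) (x := 0)
    (y := x) (C := C * τ ^ (n + 1) * (|x| ^ n / n.factorial))
    (fun s _ => (hderiv n s).hasDerivWithinAt) (fun s hs => by
      rw [norm_mul, norm_div, norm_pow, Real.norm_eq_abs, Real.norm_eq_abs, Real.norm_natCast]
      have : |x - s| ≤ |x| := by
        have h := Set.abs_sub_left_of_mem_uIcc (Set.uIcc_comm x 0 ▸ hs)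
        rwa [zero_sub, abs_neg, abs_sub_comm] at h
      gcongr
      exact hC _ _) (convex_uIcc 0 x) Set.left_mem_uIcc Set.right_mem_uIcc
  have h1 : ∑ k ∈ Finset.range (n + 1), a k x * ((x - x) ^ k / k.factorial) = a 0 x := by
    rw [Finset.sum_range_succ']
    simp
  rw [h1, sub_zero, norm_sub_rev, Real.norm_eq_abs x] at hb
  refine hb.trans_eq ?_
  rw [mul_pow]
  ring

/-- A function on the line whose `n`-th derivative is bounded by `C τ ^ n` extends to an entire
function of exponential type `τ`. -/
theorem exists_entire_extension {a : ℕ → ℝ → ℝ} {C τ : ℝ} (hτ : 0 ≤ τ)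
    (ha : ∀ n x, HasDerivAt (a n) (a (n + 1) x) x) (hC : ∀ n x, |a n x| ≤ C * τ ^ n) :
    ∃ g : ℂ → ℂ, Differentiable ℂ g ∧ (∀ x : ℝ, g x = a 0 x) ∧ deriv g 0 = a 1 0 ∧
      ∀ z, ‖g z‖ ≤ C * Real.exp (τ * |z.im|) := by
  have hC0 : 0 ≤ C := by simpa using (abs_nonneg _).trans (hC 0 0)
  have hterm : ∀ (n : ℕ) (r : ℝ) (z : ℂ), ‖z‖ ≤ r →
      ‖(a n 0 : ℂ) * (z ^ n / n.factorial)‖ ≤ C * ((τ * r) ^ n / n.factorial) := by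
    intro n r z hz
    rw [norm_mul, Complex.norm_real, norm_div, norm_pow, Complex.norm_natCast, Real.norm_eq_abs,
      mul_pow, mul_div_assoc, ← mul_assoc]
    gcongr
    exact hC n 0
  have hsum : ∀ r : ℝ, Summable fun n : ℕ => C * ((τ * r) ^ n / n.factorial) := fun r =>
    (Real.summable_pow_div_factorial (τ * r)).mul_left C
  set g : ℂ → ℂ := fun z => ∑' n : ℕ, (a n 0 : ℂ) * (z ^ n / n.factorial) with hg
  have hgd : Differentiable ℂ g := by
    intro z
    have hd := Complex.differentiableOn_tsum_of_summable_norm (hsum (‖z‖ + 1))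
      (F := fun (n : ℕ) (z : ℂ) => (a n 0 : ℂ) * (z ^ n / n.factorial))
      (fun n => Differentiable.differentiableOn (by fun_prop)) Metric.isOpen_ball
      (U := Metric.ball 0 (‖z‖ + 1)) (fun n w hw => hterm n _ w (mem_ball_zero_iff.1 hw).le)
    exact (hd z (by simp)).differentiableAt (Metric.isOpen_ball.mem_nhds (by simp))
  have hgr : ∀ x : ℝ, g x = a 0 x := by
    intro x
    have h1 := Complex.hasSum_ofReal.2 (hasSum_taylor hτ ha hC x)
    rw [← h1.tsum_eq, hg]
    simp
  refine ⟨g, hgd, hgr, ?_, ?_⟩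
  · have h1 : HasDerivAt (fun x : ℝ => g x) (deriv g 0) 0 := by
      have := (hgd 0).hasDerivAt
      exact HasDerivAt.comp_ofReal (by simpa using this)
    have h2 : HasDerivAt (fun x : ℝ => g x) (a 1 0 : ℂ) 0 := by
      simp only [hgr]
      exact (ha 0 0).ofReal_comp
    exact h1.unique h2
  · refine norm_le_exp_abs_im hgd hτ (fun z => ?_) (fun x => ?_)
    · have h1 := tsum_of_norm_bounded (hsum ‖z‖).hasSum (fun n => hterm n ‖z‖ z le_rfl)
      refine h1.trans_eq ?_
      rw [tsum_mul_left, Real.exp_eq_exp_ℝ, NormedSpace.exp_eq_tsum_div]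
    · rw [hgr, Complex.norm_real]
      simpa using hC 0 x

/-- The cardinal series on the real line. -/
theorem tendsto_cardinal_real {a : ℕ → ℝ → ℝ} {C : ℝ}
    (ha : ∀ n x, HasDerivAt (a n) (a (n + 1) x) x) (hC : ∀ n x, |a n x| ≤ C * Real.pi ^ n)
    {q : ℤ → ℝ} (hq : ∀ k : ℤ, q k * k = a 0 k - a 0 0) (hq0 : q 0 = a 1 0) (x : ℝ) :
    Tendsto (fun N : ℕ => ∑ k ∈ Finset.Icc (-(N : ℤ)) N,
      q k * (x * Real.sinc (Real.pi * (x - k)))) atTop (𝓝 (a 0 x - a 0 0)) := by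
  obtain ⟨g, hg, hgr, hg0, hB⟩ := exists_entire_extension Real.pi_pos.le ha hC
  have hg00 : g 0 = a 0 0 := by simpa using hgr 0
  have h := tendsto_cardinalSum hg hB (q := fun k => (q k : ℂ)) (fun k => by
      have := hgr k
      rw [Complex.ofReal_intCast] at this
      rw [this, hg00]
      exact_mod_cast hq k) (by rw [hq0, hg0]) x
  rw [hgr, hg00] at h
  have h2 := (Complex.continuous_re.tendsto _).comp h
  rw [← Complex.ofReal_sub, Complex.ofReal_re] at h2
  refine h2.congr fun N => ?_
  simp only [Function.comp, cardinalSum, Complex.re_sum]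
  refine Finset.sum_congr rfl fun k _ => ?_
  rw [show ((x : ℂ) - k) = ((x - k : ℝ) : ℂ) by push_cast; ring, csinc_ofReal]
  rw [← Complex.ofReal_mul, ← Complex.ofReal_mul, Complex.ofReal_re]

/-! ### Derivatives of sinc and decay of the sampling weights. -/

theorem contDiff_sinc_pi {n : WithTop ℕ∞} :
    ContDiff ℝ n (fun y : ℝ => Real.sinc (Real.pi * y)) := by
  have h : (fun y : ℝ => Real.sinc (Real.pi * y)) =
      fun y : ℝ => Complex.reCLM (csinc (Complex.ofRealCLM y)) := by
    ext y
    simp [csinc_ofReal]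
  rw [h]
  exact Complex.reCLM.contDiff.comp
    ((differentiable_csinc.contDiff.restrict_scalars ℝ).comp Complex.ofRealCLM.contDiff)

theorem hasDerivAt_sincDeriv (n : ℕ) (x : ℝ) :
    HasDerivAt (sincDeriv n) (sincDeriv (n + 1) x) x := by
  have h : Differentiable ℝ (sincDeriv n) :=
    contDiff_sinc_pi.differentiable_iteratedDeriv (n := (n + 1 : ℕ)) n
      (by exact_mod_cast Nat.lt_succ_self n)
  have h2 := (h x).hasDerivAt
  have h3 : deriv (sincDeriv n) x = sincDeriv (n + 1) x := by
    simp only [sincDeriv, iteratedDeriv_succ]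
    rfl
  rwa [h3] at h2

theorem sincDeriv_neg (n : ℕ) (x : ℝ) : sincDeriv n (-x) = (-1) ^ n * sincDeriv n x := by
  have h := iteratedDeriv_comp_neg n (fun y : ℝ => Real.sinc (Real.pi * y)) x
  have h2 : (fun y : ℝ => Real.sinc (Real.pi * -y)) = fun y => Real.sinc (Real.pi * y) := by
    ext y
    rw [mul_neg, Real.sinc_neg]
  rw [h2, smul_eq_mul] at h
  simp only [sincDeriv]
  rw [h, ← mul_assoc, ← mul_pow]
  simp

theorem sincDeriv_zero_of_odd {n : ℕ} (hn : Odd n) : sincDeriv n 0 = 0 := by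
  have h := sincDeriv_neg n 0
  rw [neg_zero, hn.neg_one_pow] at h
  linarith

/-- The `n`-th derivative of `x sinc (x - k)`. -/
noncomputable def sampleWeight (n : ℕ) (k : ℤ) (x : ℝ) : ℝ :=
  n * sincDeriv (n - 1) (x - k) + x * sincDeriv n (x - k)

theorem hasDerivAt_sampleWeight (n : ℕ) (k : ℤ) (x : ℝ) :
    HasDerivAt (sampleWeight n k) (sampleWeight (n + 1) k x) x := by
  have hs : ∀ m, HasDerivAt (fun x => sincDeriv m (x - k)) (sincDeriv (m + 1) (x - k)) x :=
    fun m => (hasDerivAt_sincDeriv m (x - k)).comp_sub_const x (k : ℝ)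
  have h := ((hs (n - 1)).const_mul (n : ℝ)).add ((hasDerivAt_id x).mul (hs n))
  refine h.congr_deriv ?_
  unfold sampleWeight
  -- At `n = 0` the truncated `n - 1` is harmless, since its coefficient is `0`.
  rcases n with _ | n
  · simp
  · simp
    ring

/-- Since `x sinc x = sin (π x) / π`, each derivative only shifts the phase. This gives both the
decay of the sinc derivatives and the zero used in the Bernstein bound. -/
theorem sampleWeight_zero_right (n : ℕ) (x : ℝ) :
    sampleWeight n 0 x = Real.pi ^ n * Real.sin (Real.pi * x + n * (Real.pi / 2)) / Real.pi := by
  induction n generalizing x with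
  | zero =>
    by_cases hx : x = 0
    · simp [sampleWeight, hx]
    · simp [sampleWeight, sincDeriv, Real.sinc_of_ne_zero, hx, Real.pi_ne_zero]
      field_simp
  | succ n ih =>
    have h1 := hasDerivAt_sampleWeight n 0 x
    have h2 : HasDerivAt (sampleWeight n 0)
        (Real.pi ^ (n + 1) * Real.sin (Real.pi * x + (n + 1 : ℕ) * (Real.pi / 2)) / Real.pi) x := by
      rw [funext ih]
      have h3 : HasDerivAt (fun x : ℝ => Real.pi * x + n * (Real.pi / 2)) Real.pi x := by
        simpa using ((hasDerivAt_id x).const_mul Real.pi).add_const (n * (Real.pi / 2))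
      refine ((h3.sin.const_mul (Real.pi ^ n)).div_const Real.pi).congr_deriv ?_
      have : Real.pi * x + ((n + 1 : ℕ) : ℝ) * (Real.pi / 2) =
        (Real.pi * x + n * (Real.pi / 2)) + Real.pi / 2 := by push_cast; ring
      rw [this, Real.sin_add_pi_div_two]
      ring
    exact h1.unique h2

theorem abs_mul_sincDeriv_le (n : ℕ) (x : ℝ) :
    |x| * |sincDeriv n x| ≤ Real.pi ^ n / Real.pi + n * |sincDeriv (n - 1) x| := by
  have h := sampleWeight_zero_right n x
  simp only [sampleWeight, Int.cast_zero, sub_zero] at h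
  have h1 : x * sincDeriv n x = Real.pi ^ n * Real.sin (Real.pi * x + n * (Real.pi / 2)) / Real.pi
      - n * sincDeriv (n - 1) x := by linarith
  rw [← abs_mul, h1]
  refine (abs_sub _ _).trans (add_le_add ?_ ?_)
  · rw [abs_div, abs_mul, abs_of_pos Real.pi_pos, abs_of_pos (pow_pos Real.pi_pos n)]
    have := Real.pi_pos
    gcongr
    exact mul_le_of_le_one_right (by positivity) (Real.abs_sin_le_one _)
  · rw [abs_mul, Nat.abs_cast]

/-- Induction on `n`: solving the phase-shift formula for `x sinc^{(n)} x` leaves a bounded sine and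
a multiple of `sinc^{(n-1)}`. Near the origin, continuity suffices. -/
theorem exists_sincDeriv_bound (n : ℕ) :
    ∃ C, 0 ≤ C ∧ ∀ x, (1 + |x|) * |sincDeriv n x| ≤ C := by
  have hpi := Real.pi_pos
  have step : ∀ m : ℕ, (∃ D, ∀ x, |x| * |sincDeriv m x| ≤ D) →
      ∃ C, 0 ≤ C ∧ ∀ x, (1 + |x|) * |sincDeriv m x| ≤ C := by
    rintro m ⟨D, hD⟩
    have hcont : Continuous (sincDeriv m) :=
      continuous_iff_continuousAt.2 fun x => (hasDerivAt_sincDeriv m x).continuousAt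
    obtain ⟨K, hK⟩ := isCompact_Icc.exists_bound_of_continuousOn (s := Set.Icc (-1 : ℝ) 1)
      hcont.continuousOn
    have hb : ∀ x, (1 + |x|) * |sincDeriv m x| ≤ 2 * max K D := by
      intro x
      rcases le_total |x| 1 with hx | hx
      · have h1 : |sincDeriv m x| ≤ max K D := le_max_of_le_left (hK x (abs_le.1 hx))
        nlinarith [abs_nonneg (sincDeriv m x)]
      · have h1 : |x| * |sincDeriv m x| ≤ max K D := le_max_of_le_right (hD x)
        nlinarith [abs_nonneg (sincDeriv m x)]
    exact ⟨2 * max K D, le_trans (by positivity) (hb 0), hb⟩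
  induction n with
  | zero => exact step 0 ⟨_, fun x => by simpa using abs_mul_sincDeriv_le 0 x⟩
  | succ n ih =>
    obtain ⟨C, hC, h⟩ := ih
    refine step (n + 1) ⟨Real.pi ^ (n + 1) / Real.pi + (n + 1 : ℕ) * C, fun x => ?_⟩
    refine (abs_mul_sincDeriv_le (n + 1) x).trans ?_
    gcongr
    refine le_trans ?_ (h x)
    simp only [Nat.add_sub_cancel]
    nlinarith [abs_nonneg x, abs_nonneg (sincDeriv n x)]

theorem exists_sincDeriv_shift_bound (n : ℕ) (r : ℝ) (hr : 0 ≤ r) :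
    ∃ C, 0 ≤ C ∧ ∀ (k : ℤ) (x : ℝ), |x| ≤ r → |(k : ℝ)| * |sincDeriv n (x - k)| ≤ C := by
  obtain ⟨C, hC, h⟩ := exists_sincDeriv_bound n
  refine ⟨(1 + r) * C, by positivity, fun k x hx => ?_⟩
  have h1 : |(k : ℝ)| ≤ (1 + r) * (1 + |x - k|) := by
    have := abs_sub_abs_le_abs_sub (k : ℝ) x
    rw [abs_sub_comm] at this
    nlinarith [abs_nonneg (x - k)]
  calc |(k : ℝ)| * |sincDeriv n (x - k)| ≤ (1 + r) * (1 + |x - k|) * |sincDeriv n (x - k)| := by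
        gcongr
    _ = (1 + r) * ((1 + |x - k|) * |sincDeriv n (x - k)|) := by ring
    _ ≤ (1 + r) * C := by gcongr; exact h _

theorem exists_sampleWeight_bound (n : ℕ) (r : ℝ) (hr : 0 ≤ r) :
    ∃ C, 0 ≤ C ∧ ∀ (k : ℤ) (x : ℝ), |x| ≤ r → |(k : ℝ)| * |sampleWeight n k x| ≤ C := by
  obtain ⟨C, hC, h⟩ := exists_sincDeriv_shift_bound (n - 1) r hr
  obtain ⟨D, hD, h'⟩ := exists_sincDeriv_shift_bound n r hr
  refine ⟨n * C + r * D, by positivity, fun k x hx => ?_⟩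
  calc |(k : ℝ)| * |sampleWeight n k x|
      ≤ |(k : ℝ)| * (n * |sincDeriv (n - 1) (x - k)| + |x| * |sincDeriv n (x - k)|) := by
        gcongr
        refine (abs_add_le _ _).trans_eq ?_
        rw [abs_mul, abs_mul, Nat.abs_cast]
    _ = n * (|(k : ℝ)| * |sincDeriv (n - 1) (x - k)|) +
        |x| * (|(k : ℝ)| * |sincDeriv n (x - k)|) := by ring
    _ ≤ n * C + r * D := by
        gcongr
        · exact h k x hx
        · exact h' k x hx

/-! ### The sampling series for vector-valued functions. -/

section CardinalSeries

variable {X : Type*} [NormedAddCommGroup X] [NormedSpace ℝ X]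

theorem norm_smul_le_inv_sq {c : ℝ} {v : X} {D V : ℝ} {k : ℤ} (hk : k ≠ 0) (hD : 0 ≤ D)
    (hc : |(k : ℝ)| * |c| ≤ D) (hv : |(k : ℝ)| * ‖v‖ ≤ V) :
    ‖c • v‖ ≤ D * V * (1 / (k : ℝ) ^ 2) := by
  have hk0 : (0 : ℝ) < |(k : ℝ)| := abs_pos.2 (by exact_mod_cast hk)
  rw [norm_smul, Real.norm_eq_abs, ← sq_abs (k : ℝ), mul_one_div, le_div_iff₀ (by positivity)]
  calc |c| * ‖v‖ * |(k : ℝ)| ^ 2 = (|(k : ℝ)| * |c|) * (|(k : ℝ)| * ‖v‖) := by ring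
    _ ≤ D * V := by gcongr

theorem summable_smul_of_decay [CompleteSpace X] {c : ℤ → ℝ} {v : ℤ → X} {D V : ℝ} (hD : 0 ≤ D)
    (hc : ∀ k : ℤ, |(k : ℝ)| * |c k| ≤ D) (hv : ∀ k : ℤ, |(k : ℝ)| * ‖v k‖ ≤ V) :
    Summable fun k => c k • v k := by
  refine Summable.of_norm_bounded_eventually
    (((Real.summable_one_div_int_pow (p := 2)).2 one_lt_two).mul_left (D * V)) ?_
  filter_upwards [(Set.finite_singleton (0 : ℤ)).compl_mem_cofinite] with k hk
  exact norm_smul_le_inv_sq hk hD (hc k) (hv k)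

theorem tendsto_Icc_neg_atTop :
    Tendsto (fun N : ℕ => Finset.Icc (-(N : ℤ)) N) atTop atTop := by
  refine tendsto_atTop_finset_of_monotone (fun m n h => ?_) fun k => ⟨k.natAbs, ?_⟩
  · exact Finset.Icc_subset_Icc (by omega) (by omega)
  · rw [Finset.mem_Icc]; omega

variable [CompleteSpace X] {a : ℕ → ℝ → X} {C : ℝ} {q : ℤ → X}

theorem summable_sampleWeight (hC : ∀ n x, ‖a n x‖ ≤ C * Real.pi ^ n)
    (hq : ∀ k : ℤ, (k : ℝ) • q k = a 0 k - a 0 0) (n : ℕ) (x : ℝ) :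
    Summable fun k => sampleWeight n k x • q k := by
  obtain ⟨D, hD, h⟩ := exists_sampleWeight_bound n |x| (abs_nonneg x)
  refine summable_smul_of_decay hD (fun k => h k x le_rfl) (V := C + C) fun k => ?_
  rw [← Real.norm_eq_abs, ← norm_smul, hq]
  have h1 := hC 0 k
  have h2 := hC 0 0
  rw [pow_zero, mul_one] at h1 h2
  exact (norm_sub_le _ _).trans (add_le_add h1 h2)

/-- Real functionals separate points, which reduces to the scalar series. There only symmetric
partial sums are known to converge, but they are cofinal among all finite sums and summability is
already available. -/
theorem tsum_sampleWeight_zero (ha : ∀ n x, HasDerivAt (a n) (a (n + 1) x) x)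
    (hC : ∀ n x, ‖a n x‖ ≤ C * Real.pi ^ n) (hq : ∀ k : ℤ, (k : ℝ) • q k = a 0 k - a 0 0)
    (hq0 : q 0 = a 1 0) (x : ℝ) :
    ∑' k, sampleWeight 0 k x • q k = a 0 x - a 0 0 := by
  refine (SeparatingDual.eq_iff_forall_dual_eq (R := ℝ)).2 fun φ => ?_
  have h1 := (φ.hasSum (summable_sampleWeight hC hq 0 x).hasSum).comp tendsto_Icc_neg_atTop
  have h2 := tendsto_cardinal_real (a := fun n x => φ (a n x)) (C := ‖φ‖ * C)
    (fun n x => φ.hasFDerivAt.comp_hasDerivAt x (ha n x)) (fun n x => by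
      refine (φ.le_opNorm _).trans ?_
      rw [mul_assoc]
      gcongr
      exact hC n x) (q := fun k => φ (q k)) (fun k => by
      rw [mul_comm, ← smul_eq_mul, ← map_smul, hq, map_sub]) (by rw [hq0]) x
  rw [map_sub]
  refine tendsto_nhds_unique h1 (h2.congr fun N => ?_)
  refine Finset.sum_congr rfl fun k _ => ?_
  simp [sampleWeight, sincDeriv]
  ring

/-- **Sampling formula** for the derivatives of a bounded vector-valued function of exponential
type `π`, in terms of its difference quotients at the integers. -/
theorem hasSum_sampleWeight (ha : ∀ n x, HasDerivAt (a n) (a (n + 1) x) x)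
    (hC : ∀ n x, ‖a n x‖ ≤ C * Real.pi ^ n) (hq : ∀ k : ℤ, (k : ℝ) • q k = a 0 k - a 0 0)
    (hq0 : q 0 = a 1 0) {n : ℕ} (hn : 1 ≤ n) (x : ℝ) :
    HasSum (fun k => sampleWeight n k x • q k) (a n x) := by
  have hstep : ∀ (n : ℕ) (x : ℝ), HasDerivAt (fun y => ∑' k, sampleWeight n k y • q k)
      (∑' k, sampleWeight (n + 1) k x • q k) x := by
    intro n x
    obtain ⟨D, hD, h⟩ := exists_sampleWeight_bound (n + 1) (|x| + 1) (by positivity)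
    -- A majorant uniform on a ball around `0` containing `x`. The index `k = 0` needs its own term
    -- because `1 / 0 ^ 2 = 0`.
    refine hasDerivAt_tsum_of_isPreconnected
      (u := fun k : ℤ => D * (C + C) * (1 / (k : ℝ) ^ 2) +
        if k = 0 then Real.pi ^ (n + 1) / Real.pi * ‖q 0‖ else 0)
      (t := Metric.ball 0 (|x| + 1)) (y₀ := x) ?_ Metric.isOpen_ball
      (convex_ball _ _).isPreconnected
      (fun k y _ => (hasDerivAt_sampleWeight n k y).smul_const (q k)) (fun k y hy => ?_)
      (by simp) (summable_sampleWeight hC hq n x) (by simp)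
    · refine (((Real.summable_one_div_int_pow (p := 2)).2 one_lt_two).mul_left _).add ?_
      exact summable_of_ne_finset_zero (s := {0}) fun k hk => by simp at hk; simp [hk]
    · rcases eq_or_ne k 0 with rfl | hk
      · rw [sampleWeight_zero_right, norm_smul, Real.norm_eq_abs, abs_div, abs_mul,
          abs_of_pos Real.pi_pos, abs_of_pos (pow_pos Real.pi_pos _)]
        have := Real.pi_pos
        simp only [Int.cast_zero, ne_eq, OfNat.ofNat_ne_zero, not_false_eq_true, zero_pow,
          div_zero, mul_zero, if_true, zero_add]
        gcongr
        exact mul_le_of_le_one_right (by positivity) (Real.abs_sin_le_one _)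
      · simp only [hk, if_false, add_zero]
        refine norm_smul_le_inv_sq hk hD (h k y (mem_ball_zero_iff.1 hy).le) ?_
        rw [← Real.norm_eq_abs, ← norm_smul, hq]
        have h1 := hC 0 k
        have h2 := hC 0 0
        rw [pow_zero, mul_one] at h1 h2
        exact (norm_sub_le _ _).trans (add_le_add h1 h2)
  -- The first differentiation removes the constant `a 0 0`, hence the start at `n = 1`.
  have hsum : ∀ x, ∑' k, sampleWeight n k x • q k = a n x := by
    induction n, hn using Nat.le_induction with
    | base =>
      intro x
      have h1 := hstep 0 x
      rw [funext fun y => tsum_sampleWeight_zero ha hC hq hq0 y] at h1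
      exact h1.unique ((ha 0 x).sub_const _)
    | succ n _ ih =>
      intro x
      have h1 := hstep n x
      rw [funext ih] at h1
      exact h1.unique (ha n x)
  rw [← hsum x]
  exact (summable_sampleWeight hC hq n x).hasSum

end CardinalSeries

/-! ### Transfer to the group: sampling formula, Bernstein bound, remainder. -/

namespace StronglyContinuousGroup

variable {𝕜 E : Type*} [RCLike 𝕜] [NormedAddCommGroup E] [NormedSpace 𝕜 E]

/-- `d` lists the vectors `D ^ n (d 0)`, which grow like those of a vector of exponential
type `σ`. -/
structure IsExponentialOrbit (T : StronglyContinuousGroup 𝕜 E) (σ : ℝ) (d : ℕ → E) (C : ℝ) :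
    Prop where
  hasVelocity : ∀ n, T.HasVelocity (d n) (d (n + 1))
  norm_le : ∀ n, ‖d n‖ ≤ C * σ ^ n

theorem generator_eq {T : StronglyContinuousGroup 𝕜 E} {f : T.generator.domain} {g : E}
    (h : T.HasVelocity f g) : T.generator f = g :=
  (T.hasVelocity_generator f).unique h

theorem isExponentialOrbit_operatorPow {T : StronglyContinuousGroup 𝕜 E} {σ : ℝ} {f : E}
    (hf : f ∈ bernsteinSpace T.generator σ) :
    T.IsExponentialOrbit σ (fun n => operatorPow T.generator n ⟨f, hf.1 n⟩) ‖f‖ where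
  hasVelocity n := T.hasVelocity_generator ⟨_, (hf.1 (n + 1)).2⟩
  norm_le n := (hf.2 n (hf.1 n)).trans_eq (mul_comm _ _)

/-- The Bernstein inequalities need not survive addition, but growth `C σ ^ n` with an arbitrary
constant does. Later bounds therefore must not depend on `C`. -/
theorem exists_isExponentialOrbit_of_mem_span {T : StronglyContinuousGroup 𝕜 E} {σ : ℝ}
    {f : E} (hf : f ∈ Submodule.span 𝕜 (bernsteinSpace T.generator σ)) :
    ∃ d C, d 0 = f ∧ T.IsExponentialOrbit σ d C := by
  induction hf using Submodule.span_induction with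
  | mem f hf => exact ⟨_, _, rfl, isExponentialOrbit_operatorPow hf⟩
  | zero => exact ⟨0, 0, rfl, fun _ => HasVelocity.zero T, fun _ => by simp⟩
  | add f g _ _ hf hg =>
    obtain ⟨d, C, rfl, h⟩ := hf
    obtain ⟨e, K, rfl, h'⟩ := hg
    refine ⟨d + e, C + K, rfl, fun n => (h.hasVelocity n).add (h'.hasVelocity n), fun n => ?_⟩
    rw [add_mul]
    exact (norm_add_le _ _).trans (add_le_add (h.norm_le n) (h'.norm_le n))
  | smul c f _ hf =>
    obtain ⟨d, C, rfl, h⟩ := hf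
    refine ⟨c • d, ‖c‖ * C, rfl, fun n => (h.hasVelocity n).smul c, fun n => ?_⟩
    rw [mul_assoc, Pi.smul_apply, norm_smul]
    gcongr
    exact h.norm_le n

section Real

variable [NormedSpace ℝ E] [IsScalarTower ℝ 𝕜 E]

theorem HasVelocity.hasDerivAt {T : StronglyContinuousGroup 𝕜 E} {f g : E}
    (h : T.HasVelocity f g) (t : ℝ) : HasDerivAt (fun t => T.op t f) (T.op t g) t := by
  rw [hasDerivAt_iff_tendsto_slope_zero]
  refine (((T.op t).continuous.tendsto g).comp h).congr fun s => ?_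
  simp only [Function.comp]
  rw [map_smul, map_sub, T.op_add, RCLike.real_smul_eq_coe_smul (K := 𝕜), RCLike.ofReal_inv]
  rfl

theorem smul_sampleQuotient (T : StronglyContinuousGroup 𝕜 E) {σ : ℝ} (hσ : 0 < σ)
    (f : T.generator.domain) (k : ℤ) :
    (k : ℝ) • (Real.pi / σ) • T.sampleQuotient σ f k =
      T.op (k * Real.pi / σ) (f : E) - (f : E) := by
  rcases eq_or_ne k 0 with rfl | hk
  · simp [T.op_zero]
  · have hk' : (k : ℝ) ≠ 0 := by exact_mod_cast hk
    have hpi := Real.pi_ne_zero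
    rw [sampleQuotient, if_neg hk, ← RCLike.ofReal_inv, ← RCLike.real_smul_eq_coe_smul (K := 𝕜),
      smul_smul, smul_smul]
    rw [show (k : ℝ) * (Real.pi / σ) * (k * Real.pi / σ)⁻¹ = 1 by field_simp, one_smul]

theorem abs_mul_norm_sampleQuotient_le (T : StronglyContinuousGroup 𝕜 E) {σ M : ℝ} (hσ : 0 < σ)
    (hM : ∀ t, ‖T.op t‖ ≤ M) (f : T.generator.domain) (k : ℤ) :
    |(k : ℝ)| * ‖T.sampleQuotient σ f k‖ ≤ σ / Real.pi * ((M + 1) * ‖(f : E)‖) := by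
  have hpi := Real.pi_pos
  have h := congrArg norm (smul_sampleQuotient T hσ f k)
  rw [norm_smul, norm_smul, Real.norm_eq_abs, Real.norm_of_nonneg (by positivity)] at h
  have h1 : ‖T.op (k * Real.pi / σ) (f : E) - (f : E)‖ ≤ (M + 1) * ‖(f : E)‖ := by
    rw [add_mul, one_mul]
    exact (norm_sub_le _ _).trans (add_le_add_left ((T.op _).le_of_opNorm_le (hM _) _) _)
  rw [← h] at h1
  refine le_trans (le_of_eq ?_) (mul_le_mul_of_nonneg_left h1 (by positivity))
  field_simp

variable [CompleteSpace E]

theorem hasSum_orbit_real (T : StronglyContinuousGroup 𝕜 E) {σ M C : ℝ} (hσ : 0 < σ)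
    (hM : ∀ t, ‖T.op t‖ ≤ M) {d : ℕ → E} (hd : T.IsExponentialOrbit σ d C)
    {f : T.generator.domain} (hf : d 0 = f) {n : ℕ} (hn : 1 ≤ n) (t : ℝ) :
    HasSum (fun k : ℤ => ((σ / Real.pi) ^ (n - 1) * sampleWeight n k (σ * t / Real.pi)) •
      T.sampleQuotient σ f k) (T.op t (d n)) := by
  have hpi := Real.pi_pos
  have hM0 : 0 ≤ M := (norm_nonneg _).trans (hM 0)
  -- Rescaling time by `π/σ` puts the sample points at the integers and turns type `σ` into type
  -- `π`; each derivative, and the quotient `q`, gains a factor `π/σ`.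
  have h := hasSum_sampleWeight
    (a := fun n x => (Real.pi / σ) ^ n • T.op (Real.pi / σ * x) (d n)) (C := M * C)
    (q := fun k => (Real.pi / σ) • T.sampleQuotient σ f k)
    (fun n x => by
      have h1 : HasDerivAt (fun x : ℝ => Real.pi / σ * x) (Real.pi / σ) x := by
        simpa using (hasDerivAt_id x).const_mul (Real.pi / σ)
      have h2 := ((hd.hasVelocity n).hasDerivAt (Real.pi / σ * x)).scomp x h1
      refine (h2.const_smul ((Real.pi / σ) ^ n)).congr_deriv ?_
      rw [smul_smul, pow_succ])
    (fun n x => by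
      rw [norm_smul, Real.norm_of_nonneg (by positivity)]
      have h1 : ‖T.op (Real.pi / σ * x) (d n)‖ ≤ M * (C * σ ^ n) :=
        ((T.op _).le_of_opNorm_le (hM _) _).trans
          (mul_le_mul_of_nonneg_left (hd.norm_le n) hM0)
      refine (mul_le_mul_of_nonneg_left h1 (by positivity)).trans_eq ?_
      rw [div_pow]
      field_simp)
    (fun k => by
      rw [smul_sampleQuotient T hσ]
      simp only [pow_zero, one_smul, mul_zero, T.op_zero, hf]
      rw [show Real.pi / σ * (k : ℝ) = k * Real.pi / σ by ring]
      rfl)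
    (by
      have h1 : T.generator f = d 1 := generator_eq (hf ▸ hd.hasVelocity 0)
      simp [sampleQuotient, h1, T.op_zero]) hn (σ * t / Real.pi)
  have h2 := h.const_smul ((σ / Real.pi) ^ n)
  rw [smul_smul, ← mul_pow, show σ / Real.pi * (Real.pi / σ) = 1 by field_simp, one_pow, one_smul,
    show Real.pi / σ * (σ * t / Real.pi) = t by field_simp] at h2
  convert h2 using 2 with k
  rw [smul_smul, smul_smul]
  congr 1
  obtain ⟨m, rfl⟩ := Nat.exists_eq_add_of_le' hn
  rw [Nat.add_sub_cancel, pow_succ]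
  field_simp

theorem hasSum_orbit (T : StronglyContinuousGroup 𝕜 E) {σ M C : ℝ} (hσ : 0 < σ)
    (hM : ∀ t, ‖T.op t‖ ≤ M) {d : ℕ → E} (hd : T.IsExponentialOrbit σ d C)
    {f : T.generator.domain} (hf : d 0 = f) {n : ℕ} (hn : 1 ≤ n) (t : ℝ) :
    HasSum (fun k : ℤ => (((σ / Real.pi) ^ (n - 1) *
      (n * sincDeriv (n - 1) (σ * t / Real.pi - k) +
        σ * t / Real.pi * sincDeriv n (σ * t / Real.pi - k)) : ℝ) : 𝕜) •
      T.sampleQuotient σ f k) (T.op t (d n)) := by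
  simpa only [RCLike.real_smul_eq_coe_smul (K := 𝕜), sampleWeight] using
    hasSum_orbit_real T hσ hM hd hf hn t

theorem summable_sincDeriv_smul (T : StronglyContinuousGroup 𝕜 E) {σ M : ℝ} (hσ : 0 < σ)
    (hM : ∀ t, ‖T.op t‖ ≤ M) (n : ℕ) (f : T.generator.domain) :
    Summable fun k : ℤ => ((sincDeriv n (-(k : ℝ)) : ℝ) : 𝕜) • T.sampleQuotient σ f k := by
  obtain ⟨D, hD, h⟩ := exists_sincDeriv_shift_bound n 0 le_rfl
  simp only [← RCLike.real_smul_eq_coe_smul (K := 𝕜)]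
  exact summable_smul_of_decay hD (fun k => by simpa using h k 0 (by simp))
    (fun k => abs_mul_norm_sampleQuotient_le T hσ hM f k)

theorem samplingOperator_eq (T : StronglyContinuousGroup 𝕜 E) {σ M C : ℝ} (hσ : 0 < σ)
    (hM : ∀ t, ‖T.op t‖ ≤ M) {d : ℕ → E} (hd : T.IsExponentialOrbit σ d C)
    {f : T.generator.domain} (hf : d 0 = f) {n : ℕ} (hn : 1 ≤ n) :
    d n = T.samplingOperator σ n f := by
  have h := hasSum_orbit T hσ hM hd hf hn 0
  rw [T.op_zero] at h
  refine h.unique ?_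
  unfold samplingOperator
  convert (summable_sincDeriv_smul T hσ hM (n - 1) f).hasSum.const_smul
    ((n * (σ / Real.pi) ^ (n - 1) : ℝ) : 𝕜) using 2 with k
  rw [smul_smul, ← RCLike.ofReal_mul]
  congr 2
  simp only [mul_zero, zero_div, zero_mul, add_zero, zero_sub]
  ring

/-- **Bernstein inequality** for vectors of exponential type. -/
theorem exists_bernstein_bound (T : StronglyContinuousGroup 𝕜 E) {σ M : ℝ} (hσ : 0 < σ)
    (hM : ∀ t, ‖T.op t‖ ≤ M) {n : ℕ} (hn : 1 ≤ n) :
    ∃ K : ℝ, ∀ (d : ℕ → E) (C : ℝ) (f : T.generator.domain), T.IsExponentialOrbit σ d C →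
      d 0 = f → ‖d n‖ ≤ K * ‖(f : E)‖ := by
  have hpi := Real.pi_pos
  have hM0 : 0 ≤ M := (norm_nonneg _).trans (hM 0)
  obtain ⟨D, hD, h⟩ := exists_sampleWeight_bound n (n / 2) (by positivity)
  have hx0 : |(n / 2 : ℝ)| ≤ n / 2 := (abs_of_nonneg (by positivity)).le
  -- The point `n / 2` turns the phase-shifted sine into `sin (n π)`, eliminating the term with `D
  -- f`, which is not controlled by `‖f‖`.
  have hw0 : sampleWeight n 0 (n / 2) = 0 := by
    rw [sampleWeight_zero_right, show Real.pi * (n / 2 : ℝ) + n * (Real.pi / 2) = n * Real.pi by ring,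
      Real.sin_nat_mul_pi]
    simp
  have hS := (Real.summable_one_div_int_pow (p := 2)).2 one_lt_two
  refine ⟨M * ((σ / Real.pi) ^ (n - 1) * D * (σ / Real.pi * (M + 1)) *
    ∑' k : ℤ, 1 / (k : ℝ) ^ 2), fun d C f hd hf => ?_⟩
  set t : ℝ := Real.pi / σ * (n / 2) with ht
  have hsum := hasSum_orbit_real T hσ hM hd hf hn t
  rw [show σ * t / Real.pi = n / 2 by rw [ht]; field_simp] at hsum
  have hb : ‖T.op t (d n)‖ ≤ (σ / Real.pi) ^ (n - 1) * D * (σ / Real.pi * ((M + 1) * ‖(f : E)‖)) *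
      ∑' k : ℤ, 1 / (k : ℝ) ^ 2 := by
    rw [← hsum.tsum_eq]
    refine tsum_of_norm_bounded (hS.hasSum.mul_left _) fun k => ?_
    rcases eq_or_ne k 0 with rfl | hk
    -- The majorant is also `0` at `k = 0`, as `1 / 0 = 0`.
    · simp [hw0]
    · refine norm_smul_le_inv_sq hk (by positivity) ?_ (abs_mul_norm_sampleQuotient_le T hσ hM f k)
      rw [abs_mul, abs_of_nonneg (by positivity : (0 : ℝ) ≤ (σ / Real.pi) ^ (n - 1)),
        mul_left_comm]
      gcongr
      exact h k _ hx0
  -- Inverting the time shift costs one more factor `M`.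
  have hinv : d n = T.op (-t) (T.op t (d n)) := by
    rw [← ContinuousLinearMap.comp_apply, ← T.op_add, neg_add_cancel, T.op_zero]
    rfl
  rw [hinv]
  refine ((T.op _).le_of_opNorm_le (hM _) _).trans ?_
  refine (mul_le_mul_of_nonneg_left hb hM0).trans_eq ?_
  ring

end Real

theorem exists_sampling_remainder [CompleteSpace E] [NormedSpace ℝ E] [IsScalarTower ℝ 𝕜 E]
    (T : StronglyContinuousGroup 𝕜 E) {σ M : ℝ} (hσ : 0 < σ)
    (hM : ∀ t, ‖T.op t‖ ≤ M) (n : ℕ) :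
    ∃ R : E →L[𝕜] E,
      (∀ f : E,
        HasSum
          (fun k : {k : ℤ // k ≠ 0} =>
            ((n * (σ / Real.pi) ^ (n - 1) * sincDeriv (n - 1) (-((k : ℤ) : ℝ)) : ℝ) : 𝕜) •
              (((k : ℤ) * Real.pi / σ : ℝ) : 𝕜)⁻¹ • (T.op ((k : ℤ) * Real.pi / σ) f - f))
          (R f)) ∧
      ∀ f : T.generator.domain,
        T.samplingOperator σ n f =
          ((n * (σ / Real.pi) ^ (n - 1) * sincDeriv (n - 1) 0 : ℝ) : 𝕜) • T.generator f +
            R f := by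
  have hpi := Real.pi_pos
  obtain ⟨D, hD, h⟩ := exists_sincDeriv_shift_bound (n - 1) 0 le_rfl
  set c : ℝ := n * (σ / Real.pi) ^ (n - 1) with hc
  have hc0 : 0 ≤ c := by positivity
  set F : {k : ℤ // k ≠ 0} → E →L[𝕜] E := fun k =>
    ((c * sincDeriv (n - 1) (-((k : ℤ) : ℝ)) : ℝ) : 𝕜) •
      (((k : ℤ) * Real.pi / σ : ℝ) : 𝕜)⁻¹ •
        (T.op ((k : ℤ) * Real.pi / σ) - ContinuousLinearMap.id 𝕜 E) with hF
  -- Without `k = 0` each quotient is a bounded operator of norm `O(1/|k|)`, and the sinc derivative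
  -- contributes another `1/|k|`.
  have hFs : Summable F := by
    have hS := ((Real.summable_one_div_int_pow (p := 2)).2 one_lt_two).mul_left
      (c * D * (σ / Real.pi * (M + 1)))
    refine Summable.of_norm_bounded (hS.subtype {k : ℤ | k ≠ 0}) fun k => ?_
    have hk : (0 : ℝ) < |((k : ℤ) : ℝ)| := abs_pos.2 (by exact_mod_cast k.2)
    have h1 : ‖T.op ((k : ℤ) * Real.pi / σ) - ContinuousLinearMap.id 𝕜 E‖ ≤ M + 1 :=
      (norm_sub_le _ _).trans (add_le_add (hM _) ContinuousLinearMap.norm_id_le)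
    have h2 := h k 0 (by simp)
    rw [zero_sub] at h2
    simp only [hF, norm_smul, norm_inv, RCLike.norm_ofReal, abs_mul, abs_div, abs_of_pos hpi,
      abs_of_pos hσ, abs_of_nonneg hc0, Function.comp]
    rw [← sq_abs ((k : ℤ) : ℝ), mul_one_div, le_div_iff₀ (by positivity)]
    calc _ = c * (|((k : ℤ) : ℝ)| * |sincDeriv (n - 1) (-((k : ℤ) : ℝ))|) * (σ / Real.pi *
          ‖T.op ((k : ℤ) * Real.pi / σ) - ContinuousLinearMap.id 𝕜 E‖) := by
          field_simp
      _ ≤ c * D * (σ / Real.pi * (M + 1)) := by gcongr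
  have hR : ∀ f : E, HasSum
      (fun k : {k : ℤ // k ≠ 0} => ((c * sincDeriv (n - 1) (-((k : ℤ) : ℝ)) : ℝ) : 𝕜) •
        (((k : ℤ) * Real.pi / σ : ℝ) : 𝕜)⁻¹ • (T.op ((k : ℤ) * Real.pi / σ) f - f))
      ((∑' k, F k) f) := fun f => hFs.hasSum.mapL (ContinuousLinearMap.apply 𝕜 E f)
  refine ⟨∑' k, F k, hR, fun f => ?_⟩
  have h1 : HasSum (fun k : ({0}ᶜ : Set ℤ) =>
      ((c * sincDeriv (n - 1) (-((k : ℤ) : ℝ)) : ℝ) : 𝕜) • T.sampleQuotient σ f k)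
      ((∑' k, F k) f) := by
    refine (hR f).congr_fun fun k => ?_
    rw [sampleQuotient, if_neg k.2]
  have h2 : HasSum (fun k : ({0} : Set ℤ) =>
      ((c * sincDeriv (n - 1) (-((k : ℤ) : ℝ)) : ℝ) : 𝕜) • T.sampleQuotient σ f k)
      (((c * sincDeriv (n - 1) 0 : ℝ) : 𝕜) • T.generator f) := by
    convert hasSum_unique _
    · simp
    · simp [sampleQuotient]
    · infer_instance
  have h3 := HasSum.add_compl (f := fun k : ℤ =>
      ((c * sincDeriv (n - 1) (-((k : ℤ) : ℝ)) : ℝ) : 𝕜) • T.sampleQuotient σ f k) h2 h1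
  refine HasSum.unique ?_ h3
  unfold samplingOperator
  convert (summable_sincDeriv_smul T hσ hM (n - 1) f).hasSum.const_smul ((c : ℝ) : 𝕜) using 2 with k
  rw [smul_smul, RCLike.ofReal_mul]

end StronglyContinuousGroup
theorem mainTheorem4 {𝕜 E : Type*} [RCLike 𝕜] [NormedAddCommGroup E] [NormedSpace 𝕜 E]
    [CompleteSpace E] (T : StronglyContinuousGroup 𝕜 E) (hT : ∃ M : ℝ, ∀ t : ℝ, ‖T.op t‖ ≤ M)
    (σ : ℝ) (hσ : 0 < σ) (n : ℕ) (hn : 1 ≤ n) :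
    -- the sampling formula for `e^{tD} D^n f`
    (∀ (f : E) (hf : f ∈ bernsteinSpace T.generator σ) (t : ℝ),
      HasSum
        (fun k : ℤ =>
          (((σ / Real.pi) ^ (n - 1) *
              (n * sincDeriv (n - 1) (σ * t / Real.pi - k) +
                σ * t / Real.pi * sincDeriv n (σ * t / Real.pi - k)) : ℝ) : 𝕜) •
            T.sampleQuotient σ ⟨f, bernsteinSpace_mem_domain hf⟩ k)
        (T.op t (operatorPow T.generator n ⟨f, hf.1 n⟩))) ∧
    -- the series defining `Q^n_D(σ)` converges on the whole domain of `D`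
    (∀ f : T.generator.domain,
      Summable fun k : ℤ =>
        ((sincDeriv (n - 1) (-(k : ℝ)) : ℝ) : 𝕜) • T.sampleQuotient σ f k) ∧
    -- its part over `k ≠ 0` is a bounded operator `R` on `E`, and `Q^n_D(σ) = R` if `n` is even
    (∃ R : E →L[𝕜] E,
      (∀ f : E,
        HasSum
          (fun k : {k : ℤ // k ≠ 0} =>
            ((n * (σ / Real.pi) ^ (n - 1) * sincDeriv (n - 1) (-((k : ℤ) : ℝ)) : ℝ) : 𝕜) •
              (((k : ℤ) * Real.pi / σ : ℝ) : 𝕜)⁻¹ • (T.op ((k : ℤ) * Real.pi / σ) f - f))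
          (R f)) ∧
      (∀ f : T.generator.domain,
        T.samplingOperator σ n f =
          ((n * (σ / Real.pi) ^ (n - 1) * sincDeriv (n - 1) 0 : ℝ) : 𝕜) • T.generator f +
            R f) ∧
      (Even n → ∀ f : T.generator.domain, T.samplingOperator σ n f = R f)) ∧
    -- `Q^n_D(σ)` is bounded in the norm of `E` on the linear span of `B_σ(D)`
    (∃ C : ℝ, ∀ f : T.generator.domain,
      (f : E) ∈ Submodule.span 𝕜 (bernsteinSpace T.generator σ) →
        ‖T.samplingOperator σ n f‖ ≤ C * ‖(f : E)‖) ∧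
    -- `D^n = Q^n_D(σ)` on `B_σ(D)`
    (∀ (f : E) (hf : f ∈ bernsteinSpace T.generator σ),
      operatorPow T.generator n ⟨f, hf.1 n⟩ =
        T.samplingOperator σ n ⟨f, bernsteinSpace_mem_domain hf⟩) := by 
  obtain ⟨M, hM⟩ := hT
  let _ : NormedSpace ℝ E := NormedSpace.restrictScalars ℝ 𝕜 E
  have _ : IsScalarTower ℝ 𝕜 E := RestrictScalars.isScalarTower ℝ 𝕜 E
  obtain ⟨R, hR, hRQ⟩ := T.exists_sampling_remainder hσ hM n
  refine ⟨fun f hf t => ?_, T.summable_sincDeriv_smul hσ hM (n - 1),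
    ⟨R, hR, hRQ, fun he f => ?_⟩, ?_, fun f hf => ?_⟩
  · exact T.hasSum_orbit hσ hM (StronglyContinuousGroup.isExponentialOrbit_operatorPow hf) rfl hn t
  -- Sinc is even, so its odd derivatives vanish at `0` and the coefficient of `D f` is zero.
  · have hodd : Odd (n - 1) := Nat.Even.sub_odd hn he odd_one
    rw [hRQ, sincDeriv_zero_of_odd hodd]
    simp
  · obtain ⟨K, hK⟩ := T.exists_bernstein_bound hσ hM hn
    refine ⟨K, fun f hf => ?_⟩
    obtain ⟨d, C, hd0, hd⟩ :=
      StronglyContinuousGroup.exists_isExponentialOrbit_of_mem_span hf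
    rw [← T.samplingOperator_eq hσ hM hd hd0 hn]
    exact hK d C f hd hd0
  · exact T.samplingOperator_eq hσ hM (StronglyContinuousGroup.isExponentialOrbit_operatorPow hf)
      rfl hn
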